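/- For an algebraic number $\alpha$ and a number field $K\ni\alpha$, let $$h(\alpha)=\frac1{[K:\mathbf{Q}]}\sum_{v} d_v\log\max\{1,|\alpha|_v\}$$ be its absolute logarithmic height, where $v$ runs over the places of $K$, $|\cdot|_v$ is normalised so that it extends the usual or a $p$-adic absolute value of $\mathbf{Q}$, and $d_v$ is the local degree. A function $f:\mathbf{C}\to\mathbf{C}$ is called transcendental over $\mathbf{C}(z)$ if no nonzero polynomial in $\mathbf{C}[X,Y]$ vanishes at all the points $(z,f(z))$, $z\in\mathbf{C}$. For an entire function $f$, a real $r>0$, an integer $D\ge 1$ and a real $N\ge 0$, let $\Sigma_{D,N}(f,r)$ be the set of the $\alpha\in\overline{\mathbf{Q}}\subset\mathbf{C}$ with $|\alpha|\le r$ such that $$f(\alpha)\in\overline{\mathbf{Q}},\qquad [\mathbf{Q}(\alpha,f(\alpha)):\mathbf{Q}]\le D,\qquad h(\alpha)\le N,\qquad h(f(\alpha))\le N.$$ Theorem. Let $\phi:[0,\infty)\to[0,\infty)$ be a function such that $\phi(x)/x\to 0$ as $x\to\infty$. There exist a strictly increasing sequence $(N_k)_{k\ge1}$ of non-negative real numbers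 tending to infinity and an entire function $f$, transcendental over $\mathbf{C}(z)$, such that $$f^{(\sigma)}(\alpha)\in\mathbf{Q}(\alpha)\qquad\text{for every }\alpha\in\overline{\mathbf{Q}}\text{ and every integer }\sigma\ge 0,$$ and such that, for every integer $D\ge1$ and every integer $k\ge D$, the set $\Sigma_{D,N_k}(f,1)$ is finite and $$\#\Sigma_{D,N_k}(f,1)\ \ge\ e^{D(D+1)\phi(N_k)-\log 2}.$$ -/

import Mathlib

/-- A function `f : ℂ → ℂ` is transcendental over `ℂ(z)` if no nonzero polynomial in two variables
with complex coefficients vanishes at all the points `(z, f z)`. -/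
def IsTranscendentalFunction (f : ℂ → ℂ) : Prop :=
  ∀ P : MvPolynomial (Fin 2) ℂ, (∀ z : ℂ, MvPolynomial.eval ![z, f z] P = 0) → P = 0

/-- The set `Σ_{D,N}(f, r)` of the algebraic numbers `α` in the closed disc of radius `r` about `0`
such that `f α` is algebraic, `[ℚ(α, f α) : ℚ] ≤ D`, `h(α) ≤ N` and `h(f α) ≤ N`,
where `h` is the absolute logarithmic (Weil) height. -/
def algebraicPoints (D : ℕ) (N : ℝ) (f : ℂ → ℂ) (r : ℝ) : Set ℂ :=
  {α : ℂ | IsAlgebraic ℚ α ∧ ‖α‖ ≤ r ∧ IsAlgebraic ℚ (f α) ∧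
    Module.finrank ℚ (IntermediateField.adjoin ℚ ({α, f α} : Set ℂ)) ≤ D ∧
    NumberField.absLogHeight₁ α ≤ N ∧ NumberField.absLogHeight₁ (f α) ≤ N}

/-! The function is a limit of polynomials `F k` over ℚ, where `F (k+1) = F k + c * G (k+1)` and `c`
is a tiny nonzero rational. Each `G (k+1)` is a multiple of `G k` and of the first `k+1` nonzero
terms of an enumeration of ℚ[X]. Minimal polynomials thus divide `G` to ever higher order, so at an
algebraic `α` every derivative is eventually frozen at the value of a rational polynomial, which
lies in ℚ(α).

`G (k+1)` also vanishes at `1/m` for `m ≤ M`, so `f (1/m) = F k (1/m)`, of height at most `log A + d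
log M` with `A`, `d` depending only on `F k`. Take this bound as `N (k+1)`: it is linear in `log M`
and `φ` is sublinear, so a large `M` gives enough points. Finiteness is Northcott's theorem.

Since `deg (F k) > k`, some large `R` has `|F k R| ≥ R ^ k + 1`; later corrections are small on that
disc, so `f` outgrows every power and is transcendental. -/

/-! ### Heights and Northcott's theorem -/

open Height NumberField in
/-- Every conjugate of `x` is bounded by the multiplicative height of `x`. -/
theorem norm_embedding_le_mulHeight₁ {K : Type*} [Field K] [NumberField K] (x : K) (τ : K →+* ℂ) :
    ‖τ x‖ ≤ mulHeight₁ x := by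
  rw [NumberField.mulHeight₁_eq]
  have hfin : (1 : ℝ) ≤ ∏ᶠ v : FinitePlace K, max (v x) 1 :=
    one_le_finprod fun _ ↦ le_max_right ..
  have hinf : ‖τ x‖ ≤ ∏ v : InfinitePlace K, max (v x) 1 ^ v.mult := by
    have hone (v : InfinitePlace K) : 1 ≤ max (v x) 1 := le_max_right ..
    calc ‖τ x‖ ≤ max (InfinitePlace.mk τ x) 1 := by
          rw [InfinitePlace.apply]; exact le_max_left ..
      _ ≤ max (InfinitePlace.mk τ x) 1 ^ (InfinitePlace.mk τ).mult :=
          le_self_pow₀ (hone _) (InfinitePlace.mult_ne_zero)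
      _ ≤ _ := by
          classical
          rw [← Finset.mul_prod_erase _ _ (Finset.mem_univ (InfinitePlace.mk τ))]
          exact le_mul_of_one_le_right (by positivity)
            (Finset.one_le_prod fun v _ ↦ one_le_pow₀ (hone v))
  exact hinf.trans (le_mul_of_one_le_right ((norm_nonneg _).trans hinf) hfin)

-- The finite places contribute the inverse norm of the ideal `(a, b)`, at most 1; the
-- multiplicities of the infinite places add up to the degree.
open Height NumberField in
theorem mulHeight₁_intCast_div_le {K : Type*} [Field K] [NumberField K] (a b : ℤ) (hb : b ≠ 0) :
    mulHeight₁ ((a : K) / b) ≤ (max |(a : ℝ)| |(b : ℝ)|) ^ Module.finrank ℚ K := by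
  set x : Fin 2 → 𝓞 K := ![a, b]
  have hx : x ≠ 0 := fun h ↦ hb <| by simpa [x] using congrFun h 1
  have hxe : ![(a : K), b] = fun i ↦ (x i : K) := by
    ext i; fin_cases i <;> simp [x]
  have hx' : (fun i ↦ (x i : K)) ≠ 0 := fun h ↦ hx <| funext fun i ↦ by
    simpa using congrFun h i
  have hnorm := absNorm_mul_finprod_finitePlace_eq_one hx
  have habs : (1 : ℝ) ≤ (Ideal.span (Set.range x)).absNorm := by
    refine Nat.one_le_cast.mpr (Nat.one_le_iff_ne_zero.mpr fun h ↦ ?_)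
    simp [h] at hnorm
  have hpos : 0 < ∏ᶠ v : FinitePlace K, ⨆ i, v (x i : K) :=
    pos_of_mul_pos_right (hnorm ▸ one_pos) (by positivity)
  have hfin : ∏ᶠ v : FinitePlace K, ⨆ i, v (x i : K) ≤ 1 :=
    (le_mul_of_one_le_left hpos.le habs).trans hnorm.le
  rw [mulHeight₁_div_eq_mulHeight, hxe, NumberField.mulHeight_eq hx', ← InfinitePlace.sum_mult_eq,
    ← Finset.prod_pow_eq_pow_sum]
  refine (mul_le_of_le_one_right ?_ hfin).trans ?_
  · exact Finset.prod_nonneg fun v _ ↦ pow_nonneg (Real.iSup_nonneg fun i ↦ apply_nonneg v _) _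
  · refine Finset.prod_le_prod (fun v _ ↦ pow_nonneg (Real.iSup_nonneg fun i ↦ apply_nonneg v _) _)
      fun v _ ↦ pow_le_pow_left₀ (Real.iSup_nonneg fun i ↦ apply_nonneg v _) (ciSup_le fun i ↦ ?_) _
    rw [← InfinitePlace.norm_embedding_eq]
    fin_cases i <;> simp [x]

open Height NumberField IntermediateField in
theorem absLogHeight₁_eq_log_div {K : Type*} [Field K] [CharZero K] {x : K} (hx : IsIntegral ℚ x)
    [NumberField ℚ⟮x⟯] :
    absLogHeight₁ x = Real.log (mulHeight₁ (AdjoinSimple.gen ℚ x)) / Module.finrank ℚ ℚ⟮x⟯ := by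
  rw [absLogHeight₁, absMulHeight₁, dif_pos hx, Real.log_rpow (by exact mulHeight₁_pos _)]
  rw [div_eq_inv_mul]

open NumberField IntermediateField in
/-- The height of a fraction is at most the logarithm of its largest entry. -/
theorem absLogHeight₁_intCast_div_le (a b : ℤ) (hb : b ≠ 0) {B : ℝ} (ha : |(a : ℝ)| ≤ B)
    (hbB : |(b : ℝ)| ≤ B) : absLogHeight₁ ((a : ℂ) / b) ≤ Real.log B := by
  have hx : IsIntegral ℚ ((a : ℂ) / b) := by
    have := isIntegral_algebraMap (R := ℚ) (A := ℂ) (x := (a : ℚ) / b)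
    simpa using this
  have : FiniteDimensional ℚ ℚ⟮(a : ℂ) / b⟯ := adjoin.finiteDimensional hx
  have : NumberField ℚ⟮(a : ℂ) / b⟯ := {}
  have hgen : AdjoinSimple.gen ℚ ((a : ℂ) / b) = (a : ℚ⟮(a : ℂ) / b⟯) / b := by
    apply Subtype.ext
    simp
  have hpos : (0 : ℝ) < Module.finrank ℚ ℚ⟮(a : ℂ) / b⟯ := mod_cast Module.finrank_pos
  have hb1 : (1 : ℝ) ≤ |(b : ℝ)| := mod_cast Int.one_le_abs hb
  rw [absLogHeight₁_eq_log_div hx, div_le_iff₀ hpos, mul_comm, ← Real.log_pow, hgen]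
  refine Real.log_le_log (Height.mulHeight₁_pos _) ((mulHeight₁_intCast_div_le a b hb).trans ?_)
  gcongr
  exact max_le ha hbB

open NumberField IntermediateField in
/-- **Northcott's theorem**: there are finitely many algebraic numbers of bounded degree and
height. -/
theorem finite_setOf_finrank_le_absLogHeight₁_le (D : ℕ) (N : ℝ) :
    {α : ℂ | IsAlgebraic ℚ α ∧ Module.finrank ℚ ℚ⟮α⟯ ≤ D ∧ absLogHeight₁ α ≤ N}.Finite := by
  classical
  set B : ℝ := Real.exp (D * max N 0) with hB
  have hB1 : 1 ≤ B := Real.one_le_exp (by positivity)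
  set U : Set ℤ := {c : ℤ | |(c : ℝ)| ≤ (B * B) ^ D * 2 ^ D}
  have hU : U.Finite := by
    refine (Set.finite_Icc (-⌈(B * B) ^ D * 2 ^ D⌉) ⌈(B * B) ^ D * 2 ^ D⌉).subset fun c hc ↦ ?_
    have hc' := abs_le.mp (Set.mem_ofPred_eq ▸ hc)
    constructor
    · have : (-⌈(B * B) ^ D * 2 ^ D⌉ : ℝ) ≤ c := by
        linarith [Int.le_ceil ((B * B) ^ D * 2 ^ D)]
      exact_mod_cast this
    · have : (c : ℝ) ≤ ⌈(B * B) ^ D * 2 ^ D⌉ := hc'.2.trans (Int.le_ceil _)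
      exact_mod_cast this
  have hroots := Polynomial.bUnion_roots_finite (algebraMap ℤ ℂ) D hU
  refine (Set.Finite.image2 (fun β (n : ℕ) ↦ β / (n : ℂ)) hroots (Set.finite_Iic ⌊B⌋₊)).subset ?_
  rintro α ⟨hα, hdeg, hN⟩
  have hint : IsIntegral ℚ α := hα.isIntegral
  have : FiniteDimensional ℚ ℚ⟮α⟯ := adjoin.finiteDimensional hint
  have : NumberField ℚ⟮α⟯ := {}
  set g := AdjoinSimple.gen ℚ α
  have hpos : (0 : ℝ) < Module.finrank ℚ ℚ⟮α⟯ := mod_cast Module.finrank_pos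
  have hH : Height.mulHeight₁ g ≤ B := by
    rw [absLogHeight₁_eq_log_div hint, div_le_iff₀ hpos] at hN
    rw [hB, ← Real.log_le_iff_le_exp (Height.mulHeight₁_pos _)]
    have hdeg' : (Module.finrank ℚ ℚ⟮α⟯ : ℝ) ≤ D := mod_cast hdeg
    calc _ ≤ N * Module.finrank ℚ ℚ⟮α⟯ := hN
      _ ≤ max N 0 * Module.finrank ℚ ℚ⟮α⟯ := by gcongr; exact le_max_left ..
      _ ≤ max N 0 * D := by gcongr
      _ = _ := mul_comm ..
  -- `n` is a denominator of `α` bounded by the height, so `n * α` is integral with all conjugates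
  -- at most `B * B`; this leaves finitely many minimal polynomials.
  obtain ⟨n, hn0, hnH, hnint⟩ := exists_nat_le_mulHeight₁ g
  have hnB : (n : ℝ) ≤ B := hnH.trans hH
  have hcoeff (i : ℕ) := Embeddings.coeff_bdd_of_norm_le (K := ℚ⟮α⟯) (A := ℂ) (x := n * g)
    (B := B * B) (fun τ ↦ by
      rw [map_mul, norm_mul]
      simp only [map_natCast, RCLike.norm_natCast]
      gcongr
      exact (norm_embedding_le_mulHeight₁ g τ).trans hH) i
  refine Set.mem_image2.mpr ⟨n * α, ?_, n, Nat.le_floor hnB, ?_⟩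
  · refine Set.mem_iUnion₂.mpr ⟨minpoly ℤ ((n : ℚ⟮α⟯) * g), ⟨?_, fun i ↦ ?_⟩, ?_⟩
    · rw [← (minpoly.monic hnint).natDegree_map (algebraMap ℤ ℚ),
        ← minpoly.isIntegrallyClosed_eq_field_fractions' ℚ hnint]
      exact (minpoly.natDegree_le _).trans hdeg
    · have := hcoeff i
      rw [minpoly.isIntegrallyClosed_eq_field_fractions' ℚ hnint, Polynomial.coeff_map] at this
      simp only [eq_intCast, Int.norm_cast_rat, Int.norm_eq_abs] at this
      have hBB : 1 ≤ B * B := one_le_mul_of_one_le_of_one_le hB1 hB1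
      refine this.trans ?_
      rw [max_eq_left hBB]
      gcongr ?_ * ?_
      · exact pow_le_pow_right₀ hBB hdeg
      · calc _ ≤ (2 ^ Module.finrank ℚ ℚ⟮α⟯ : ℝ) := mod_cast Nat.choose_le_two_pow ..
          _ ≤ _ := pow_le_pow_right₀ one_le_two hdeg
    · have h0 : Polynomial.aeval ((n : ℚ⟮α⟯) * g) (minpoly ℤ ((n : ℚ⟮α⟯) * g)) = 0 :=
        minpoly.aeval ..
      have h1 := congrArg (algebraMap ℚ⟮α⟯ ℂ) h0
      rw [← Polynomial.aeval_algebraMap_apply] at h1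
      simp only [Finset.mem_coe, Multiset.mem_toFinset]
      rw [Polynomial.mem_roots ((minpoly.monic hnint).map _).ne_zero, Polynomial.IsRoot,
        Polynomial.eval_map_algebraMap]
      simpa [g] using h1
  · have : (n : ℂ) ≠ 0 := mod_cast hn0
    simp [this]

/-! ### Transcendence from growth -/

open Filter Topology in
/-- A function that grows faster than every power of `z` along a sequence is transcendental. -/
theorem isTranscendentalFunction_of_growth {f : ℂ → ℂ} {x : ℕ → ℝ} (hx : Tendsto x atTop atTop)
    (hf : ∀ k, x k ^ k ≤ ‖f (x k)‖) :
    IsTranscendentalFunction f := by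
  intro P hP
  by_contra hne
  -- The leading monomial, with the degree in `Y` compared first, dominates all others along `x k`;
  -- dividing by it forces its coefficient to vanish.
  obtain ⟨t, ht, hmax⟩ := Finset.exists_max_image P.support
    (fun m : Fin 2 →₀ ℕ ↦ toLex (m 1, m 0)) (MvPolynomial.support_nonempty.mpr hne)
  have hx0 : ∀ᶠ k in atTop, 1 ≤ x k := hx.eventually_ge_atTop 1
  have hf0 : ∀ᶠ k in atTop, f (x k) ≠ 0 := by
    filter_upwards [hx0] with k hk
    rw [← norm_pos_iff]
    exact (pow_pos (by linarith) k).trans_le (hf k)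
  have hx_inv : Tendsto (fun k ↦ (x k)⁻¹) atTop (𝓝 0) := hx.inv_tendsto_atTop
  have hpow (A : ℕ) : Tendsto (fun k ↦ x k ^ A * ‖f (x k)‖⁻¹) atTop (𝓝 0) := by
    refine squeeze_zero' (hx0.mono fun k hk ↦ by positivity) ?_ hx_inv
    filter_upwards [hx0, eventually_ge_atTop (A + 1)] with k hk hkA
    have hxp : 0 < x k := by linarith
    have h1 : x k ^ (A + 1) ≤ ‖f (x k)‖ := (pow_le_pow_right₀ hk hkA).trans (hf k)
    have hfp : 0 < ‖f (x k)‖ := (pow_pos hxp _).trans_le h1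
    rw [← div_eq_mul_inv, ← one_div, div_le_div_iff₀ hfp hxp, one_mul, ← pow_succ]
    exact h1
  have key (m : Fin 2 →₀ ℕ) (hm : m ∈ P.support) (hmt : m ≠ t) :
      Tendsto (fun k ↦ (x k : ℂ) ^ m 0 * f (x k) ^ m 1 / ((x k : ℂ) ^ t 0 * f (x k) ^ t 1))
        atTop (𝓝 0) := by
    have hle := hmax m hm
    rw [Prod.Lex.toLex_le_toLex] at hle
    rw [tendsto_zero_iff_norm_tendsto_zero]
    rcases hle with hlt | ⟨heq, hle⟩
    · refine squeeze_zero' (Eventually.of_forall fun k ↦ norm_nonneg _) ?_ (hpow (m 0))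
      filter_upwards [hx0, hf0] with k hk hk0
      have hxp : 0 < x k := by linarith
      have hf1 : 1 ≤ ‖f (x k)‖ := (one_le_pow₀ hk).trans (hf k)
      simp only [norm_div, norm_mul, norm_pow, Complex.norm_real, Real.norm_eq_abs,
        abs_of_pos hxp]
      rw [← div_eq_mul_inv, div_le_div_iff₀ (by positivity) (by positivity)]
      have h2 : ‖f (x k)‖ ^ m 1 * ‖f (x k)‖ ≤ ‖f (x k)‖ ^ t 1 := by
        rw [← pow_succ]; exact pow_le_pow_right₀ hf1 hlt
      have h3 : 1 ≤ x k ^ t 0 := one_le_pow₀ hk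
      calc x k ^ m 0 * ‖f (x k)‖ ^ m 1 * ‖f (x k)‖
          = x k ^ m 0 * (1 * (‖f (x k)‖ ^ m 1 * ‖f (x k)‖)) := by ring
        _ ≤ x k ^ m 0 * (x k ^ t 0 * ‖f (x k)‖ ^ t 1) := by gcongr
    · simp only at heq hle
      have hlt : m 0 < t 0 := lt_of_le_of_ne hle fun h ↦ hmt <| by
        ext i; fin_cases i <;> assumption
      refine squeeze_zero' (Eventually.of_forall fun k ↦ norm_nonneg _) ?_ hx_inv
      filter_upwards [hx0, hf0] with k hk hk0
      have hxp : 0 < x k := by linarith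
      have hf1 : 0 < ‖f (x k)‖ := norm_pos_iff.mpr hk0
      simp only [norm_div, norm_mul, norm_pow, Complex.norm_real, Real.norm_eq_abs,
        abs_of_pos hxp]
      rw [← one_div, div_le_div_iff₀ (by positivity) hxp, heq, one_mul]
      calc x k ^ m 0 * ‖f (x k)‖ ^ t 1 * x k = x k ^ (m 0 + 1) * ‖f (x k)‖ ^ t 1 := by ring
        _ ≤ _ := by gcongr; exact hlt
  have hlim : Tendsto (fun k ↦ ∑ m ∈ P.support, P.coeff m *
      ((x k : ℂ) ^ m 0 * f (x k) ^ m 1 / ((x k : ℂ) ^ t 0 * f (x k) ^ t 1))) atTop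
      (𝓝 (∑ m ∈ P.support, if m = t then P.coeff t else 0)) := by
    refine tendsto_finsetSum _ fun m hm ↦ ?_
    split_ifs with h
    · subst h
      refine tendsto_const_nhds.congr' ?_
      filter_upwards [hx0, hf0] with k hk hk0
      have hxk : (x k : ℂ) ≠ 0 := by
        have : x k ≠ 0 := by linarith
        exact_mod_cast this
      rw [div_self (by positivity), mul_one]
    · simpa using (key m hm h).const_mul (P.coeff m)
  have hzero (k : ℕ) : ∑ m ∈ P.support, P.coeff m *
      ((x k : ℂ) ^ m 0 * f (x k) ^ m 1 / ((x k : ℂ) ^ t 0 * f (x k) ^ t 1)) = 0 := by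
    have h := hP (x k)
    rw [MvPolynomial.eval_eq'] at h
    simp only [Fin.prod_univ_two, Matrix.cons_val_zero, Matrix.cons_val_one] at h
    simp_rw [← mul_div_assoc]
    rw [← Finset.sum_div, h, zero_div]
  simp only [hzero, Finset.sum_ite_eq', ht, if_true] at hlim
  exact MvPolynomial.mem_support_iff.mp ht (tendsto_nhds_unique hlim tendsto_const_nhds)

/-! ### Estimates for rational polynomials -/

open Filter Topology Polynomial NumberField

theorem exists_pow_add_one_le_norm_aeval {F : ℚ[X]} {k : ℕ} (hk : k < F.natDegree) (r : ℝ) :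
    ∃ R, r ≤ R ∧ R ^ k + 1 ≤ ‖aeval (R : ℂ) F‖ := by
  have hdeg : (X ^ k : ℝ[X]).degree < (F.map (algebraMap ℚ ℝ)).degree := by
    rw [degree_X_pow, degree_map, degree_eq_natDegree (ne_zero_of_natDegree_gt hk)]
    exact mod_cast hk
  have h := abs_div_tendsto_atTop_atTop_of_degree_gt _ _ hdeg (by simp)
  obtain ⟨R, h2, h1, hr⟩ := ((h.eventually_ge_atTop 2).and
    ((eventually_ge_atTop 1).and (eventually_ge_atTop r))).exists
  refine ⟨R, hr, ?_⟩
  have hR : 1 ≤ R ^ k := one_le_pow₀ h1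
  rw [eval_pow, eval_X, abs_div, abs_of_pos (by linarith : 0 < R ^ k),
    le_div_iff₀ (by linarith)] at h2
  have he : aeval (R : ℂ) F = ((F.map (algebraMap ℚ ℝ)).eval R : ℝ) := by
    rw [eval_map_algebraMap]
    exact aeval_algebraMap_apply ℂ R F
  rw [he, Complex.norm_real, Real.norm_eq_abs]
  linarith

theorem exists_rat_norm_aeval_C_mul_le (G : ℚ[X]) (R : ℝ) {ε : ℝ} (hε : 0 < ε) :
    ∃ c : ℚ, c ≠ 0 ∧ ∀ z : ℂ, ‖z‖ ≤ R → ‖aeval z (C c * G)‖ ≤ ε := by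
  obtain ⟨B, hB⟩ := (isCompact_closedBall (0 : ℂ) R).exists_bound_of_continuousOn
    (f := fun z ↦ aeval z G) (G.continuous_aeval.continuousOn)
  obtain ⟨c, hc0, hc⟩ := exists_rat_btwn (show (0 : ℝ) < ε / (|B| + 1) by positivity)
  have hc0' : 0 < c := mod_cast hc0
  refine ⟨c, hc0'.ne', fun z hz ↦ ?_⟩
  have hz' := (hB z (by simpa using hz)).trans (le_abs_self B)
  rw [lt_div_iff₀ (by positivity)] at hc
  rw [map_mul, aeval_C, norm_mul, eq_ratCast, Complex.norm_ratCast, abs_of_pos hc0]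
  nlinarith

/-- Values of a rational polynomial at `1 / m` have numerator and denominator of polynomial
growth. -/
theorem exists_eval_inv_eq_div (F : ℚ[X]) : ∃ A d : ℕ, ∀ m : ℕ, 1 ≤ m → ∃ a b : ℤ, b ≠ 0 ∧
    F.eval ((m : ℚ)⁻¹) = a / b ∧ |(a : ℝ)| ≤ A * m ^ d ∧ |(b : ℝ)| ≤ A * m ^ d := by
  induction F using Polynomial.induction_on' with
  | add p q hp hq =>
    obtain ⟨A, d, hA⟩ := hp
    obtain ⟨A', d', hA'⟩ := hq
    refine ⟨2 * (A * A'), d + d', fun m hm ↦ ?_⟩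
    obtain ⟨a, b, hb, he, h1, h2⟩ := hA m hm
    obtain ⟨a', b', hb', he', h1', h2'⟩ := hA' m hm
    have h11 := mul_le_mul h1 h2' (abs_nonneg _) (by positivity)
    have h22 := mul_le_mul h2 h2' (abs_nonneg _) (by positivity)
    have h21 := mul_le_mul h2 h1' (abs_nonneg _) (by positivity)
    have hm2 : (A : ℝ) * m ^ d * (A' * m ^ d') = A * A' * m ^ (d + d') := by ring
    rw [← abs_mul, hm2] at h11 h22 h21
    have h0 : (0 : ℝ) ≤ A * A' * m ^ (d + d') := by positivity
    refine ⟨a * b' + b * a', b * b', mul_ne_zero hb hb', ?_, ?_, ?_⟩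
    · rw [eval_add, he, he', div_add_div _ _ (mod_cast hb) (mod_cast hb')]
      push_cast
      ring
    · push_cast
      linarith [abs_add_le ((a : ℝ) * b') (b * a')]
    · push_cast
      linarith
  | monomial n q =>
    refine ⟨q.num.natAbs + q.den, n, fun m hm ↦ ⟨q.num, q.den * m ^ n, ?_, ?_, ?_, ?_⟩⟩
    · have := q.den_nz
      positivity
    · rw [eval_monomial]
      push_cast
      rw [← div_div, Rat.num_div_den, inv_pow, div_eq_mul_inv]
    · have h : (1 : ℝ) ≤ (m : ℝ) ^ n := one_le_pow₀ (mod_cast hm)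
      push_cast
      rw [Nat.cast_natAbs, Int.cast_abs]
      nlinarith [abs_nonneg (q.num : ℝ), (Nat.cast_nonneg q.den : (0 : ℝ) ≤ q.den)]
    · push_cast
      rw [abs_of_nonneg (by positivity)]
      gcongr
      simp

theorem exists_absLogHeight₁_aeval_inv_le (F : ℚ[X]) : ∃ A d : ℕ, 1 ≤ A ∧ 1 ≤ d ∧
    ∀ m : ℕ, 1 ≤ m → absLogHeight₁ (aeval ((m : ℂ)⁻¹) F) ≤ Real.log A + d * Real.log m := by
  obtain ⟨A, d, h⟩ := exists_eval_inv_eq_div F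
  refine ⟨A + 1, d + 1, by simp, by simp, fun m hm ↦ ?_⟩
  obtain ⟨a, b, hb, he, ha, hb'⟩ := h m hm
  have hm1 : (1 : ℝ) ≤ m := mod_cast hm
  have hB : (A : ℝ) * m ^ d ≤ (A + 1 : ℕ) * m ^ (d + 1) := by
    gcongr <;> simp
  have hval : aeval ((m : ℂ)⁻¹) F = (a : ℂ) / b := by
    have : (m : ℂ)⁻¹ = algebraMap ℚ ℂ (m : ℚ)⁻¹ := by simp
    rw [this, aeval_algebraMap_apply, coe_aeval_eq_eval, he]
    simp
  rw [hval, ← Real.log_pow, ← Real.log_mul (by positivity) (by positivity)]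
  exact absLogHeight₁_intCast_div_le a b hb (ha.trans hB) (hb'.trans hB)

/-- A sublinear function is eventually dominated along `log A + d log M`. -/
theorem exists_exp_mul_le {φ : ℝ → ℝ} (hφ : Tendsto (fun x : ℝ ↦ φ x / x) atTop (𝓝 0))
    {K : ℝ} (hK : 0 < K) {A d : ℕ} (hA : 1 ≤ A) (hd : 1 ≤ d) (N₀ : ℝ) :
    ∃ M : ℕ, 1 ≤ M ∧ N₀ ≤ Real.log A + d * Real.log M ∧
      Real.exp (K * φ (Real.log A + d * Real.log M) - Real.log 2) ≤ M := by
  have hd0 : (0 : ℝ) < d := mod_cast hd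
  have hlog : Tendsto (fun M : ℕ ↦ Real.log M) atTop atTop :=
    Real.tendsto_log_atTop.comp tendsto_natCast_atTop_atTop
  have hlim : Tendsto (fun M : ℕ ↦ Real.log A + d * Real.log M) atTop atTop :=
    tendsto_atTop_add_const_left _ _ (hlog.const_mul_atTop hd0)
  -- The threshold gives `K * φ N ≤ N / (2 * d)`, while `N ≤ 2 * d * log M` once `A ≤ M`.
  have hsmall := (hlim.eventually (hφ.eventually_lt_const
    (show (0 : ℝ) < 1 / (2 * d * K) by positivity)))
  obtain ⟨M, hM, hN, hN1, hM1, hMA⟩ := (hsmall.and ((hlim.eventually_ge_atTop N₀).and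
    ((hlim.eventually_ge_atTop 1).and ((eventually_ge_atTop 1).and (eventually_ge_atTop A))))).exists
  refine ⟨M, hM1, hN, ?_⟩
  set N := Real.log A + d * Real.log M with hNdef
  have hM0 : (0 : ℝ) < M := mod_cast hM1
  rw [← Real.le_log_iff_exp_le hM0]
  rw [div_lt_div_iff₀ (by linarith) (by positivity)] at hM
  have hAM : Real.log A ≤ Real.log M := Real.log_le_log (mod_cast hA) (mod_cast hMA)
  have hA0 : 0 ≤ Real.log A := Real.log_natCast_nonneg _
  have hd1 : (1 : ℝ) ≤ d := mod_cast hd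
  have h1 : 2 * d * (K * φ N) ≤ 2 * d * Real.log M := by nlinarith
  have h2 : K * φ N ≤ Real.log M := le_of_mul_le_mul_left h1 (by positivity)
  linarith [Real.log_nonneg one_le_two]

/-! ### The inductive construction -/

/-- One stage in the construction of an entire function as a limit of the polynomials `F`;
the next stages change `F` by multiples of `G`. -/
structure Stage where
  F : ℚ[X]
  G : ℚ[X]
  N : ℝ
  R : ℝ

structure Stage.Valid (k : ℕ) (s : Stage) : Prop where
  G_ne_zero : s.G ≠ 0
  natDegree_eq : s.F.natDegree = s.G.natDegree
  lt_natDegree : k < s.F.natDegree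

/-- `t` may follow `s` as stage `k + 1`, where `e` enumerates the polynomials that have to divide
the corrections. -/
structure Stage.Next (φ : ℝ → ℝ) (e : ℕ → ℚ[X]) (k : ℕ) (s t : Stage) : Prop where
  dvd : s.G ∣ t.G
  mul_dvd : ∀ j ≤ k, e j ≠ 0 → s.G * e j ∣ t.G
  dvd_sub : t.G ∣ t.F - s.F
  N_le : s.N + 1 ≤ t.N
  R_le : s.R + 1 ≤ t.R
  growth : t.R ^ k + 1 ≤ ‖aeval (t.R : ℂ) s.F‖
  norm_sub_le : ∀ z : ℂ, ‖z‖ ≤ t.R → ‖aeval z t.F - aeval z s.F‖ ≤ (1 / 2) ^ (k + 1)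
  points : ∃ M : ℕ, Real.exp (((k + 1 : ℕ) : ℝ) * ((k + 1 : ℕ) + 1) * φ t.N - Real.log 2) ≤ M ∧
    ∀ m : ℕ, 1 ≤ m → m ≤ M → aeval ((m : ℂ)⁻¹) t.G = 0 ∧ Real.log m ≤ t.N ∧
      absLogHeight₁ (aeval ((m : ℂ)⁻¹) s.F) ≤ t.N

/-- The order of choices matters: `R`, `A`, `d` and then `M` depend only on the old stage; they fix
`G`, and `c` is chosen last, small on the disc of radius `R`. -/
theorem Stage.Valid.exists_next {φ : ℝ → ℝ} (hφ : Tendsto (fun x : ℝ ↦ φ x / x) atTop (𝓝 0))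
    (e : ℕ → ℚ[X]) {k : ℕ} {s : Stage} (hs : s.Valid k) :
    ∃ t : Stage, t.Valid (k + 1) ∧ s.Next φ e k t := by
  obtain ⟨R, hR, hgrowth⟩ := exists_pow_add_one_le_norm_aeval hs.lt_natDegree (s.R + 1)
  obtain ⟨A, d, hA, hd, hheight⟩ := exists_absLogHeight₁_aeval_inv_le s.F
  obtain ⟨M, hM1, hN, hM⟩ := exists_exp_mul_le hφ
    (show (0 : ℝ) < ((k + 1 : ℕ) : ℝ) * ((k + 1 : ℕ) + 1) by positivity) hA hd (s.N + 1)
  set E : ℚ[X] := ∏ j ∈ Finset.range (k + 1), if e j = 0 then 1 else e j with hEdef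
  set V : ℚ[X] := ∏ m ∈ Finset.Icc 1 M, (X - C (m : ℚ)⁻¹) with hVdef
  have hE : E ≠ 0 := Finset.prod_ne_zero_iff.mpr fun j _ ↦ by split_ifs with h <;> simp [h]
  have hV : V ≠ 0 := Finset.prod_ne_zero_iff.mpr fun m _ ↦ X_sub_C_ne_zero _
  -- The factor `X` guarantees that the degree grows.
  set G : ℚ[X] := s.G * (E * (V * X)) with hGdef
  have hVX : V * X ≠ 0 := mul_ne_zero hV X_ne_zero
  have hG : G ≠ 0 := mul_ne_zero hs.G_ne_zero (mul_ne_zero hE hVX)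
  have hGdeg : s.F.natDegree < G.natDegree := by
    rw [hGdef, natDegree_mul hs.G_ne_zero (mul_ne_zero hE hVX), natDegree_mul hE hVX,
      natDegree_mul hV X_ne_zero, natDegree_X, hs.natDegree_eq]
    omega
  obtain ⟨c, hc, hsmall⟩ := exists_rat_norm_aeval_C_mul_le G R
    (show (0 : ℝ) < (1 / 2) ^ (k + 1) by positivity)
  have hF : (s.F + C c * G).natDegree = G.natDegree := by
    rw [natDegree_add_eq_right_of_natDegree_lt] <;> rw [natDegree_C_mul hc]
    exact hGdeg
  refine ⟨⟨s.F + C c * G, G, Real.log A + d * Real.log M, R⟩, ⟨hG, hF, ?_⟩,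
    ⟨dvd_mul_right _ _, fun j hj hej ↦ ?_, ?_, hN, hR, hgrowth, fun z hz ↦ ?_, M, hM,
      fun m hm hmM ↦ ⟨?_, ?_, ?_⟩⟩⟩
  · have := hs.lt_natDegree
    simp only [hF]
    omega
  · refine mul_dvd_mul_left _ (Dvd.dvd.mul_right ?_ _)
    have := Finset.dvd_prod_of_mem (fun j ↦ if e j = 0 then 1 else e j)
      (Finset.mem_range.mpr (Nat.lt_succ_of_le hj))
    simpa only [if_neg hej] using this
  · simp
  · simpa using hsmall z hz
  · have hdvd : X - C (m : ℚ)⁻¹ ∣ G := by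
      refine Dvd.dvd.mul_left (Dvd.dvd.mul_left (Dvd.dvd.mul_right ?_ _) _) _
      exact Finset.dvd_prod_of_mem (fun m : ℕ ↦ X - C (m : ℚ)⁻¹) (Finset.mem_Icc.mpr ⟨hm, hmM⟩)
    obtain ⟨q, hq⟩ := hdvd
    simp [hq]
  · have h1 : Real.log m ≤ Real.log M := Real.log_le_log (mod_cast hm) (mod_cast hmM)
    have h2 : 0 ≤ Real.log M := Real.log_natCast_nonneg _
    have h3 : 0 ≤ Real.log A := Real.log_natCast_nonneg _
    have h4 : (1 : ℝ) ≤ d := mod_cast hd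
    simp only
    nlinarith
  · refine (hheight m hm).trans ?_
    simp only
    gcongr

/-! ### Passage to the limit -/

theorem exists_tendstoLocallyUniformlyOn_of_norm_sub_le {u : ℕ → ℂ → ℂ} {R : ℕ → ℝ}
    (hR : ∀ k, R k + 1 ≤ R (k + 1))
    (hu : ∀ k z, ‖z‖ ≤ R (k + 1) → ‖u (k + 1) z - u k z‖ ≤ (1 / 2) ^ (k + 1)) :
    ∃ f : ℂ → ℂ, TendstoLocallyUniformlyOn u f atTop Set.univ ∧
      ∀ k z, ‖z‖ ≤ R (k + 1) → ‖f z - u k z‖ ≤ (1 / 2) ^ k := by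
  have hmono : Monotone R := monotone_nat_of_le_succ fun k ↦ by linarith [hR k]
  have hRtop : Tendsto R atTop atTop := by
    have hRn (n : ℕ) : R 0 + n ≤ R n := by
      induction n with
      | zero => simp
      | succ n ih => push_cast; linarith [hR n]
    exact tendsto_atTop_mono hRn (tendsto_atTop_add_const_left _ _ tendsto_natCast_atTop_atTop)
  -- Keeping the subtracted term `(1 / 2) ^ n` lets the geometric sum telescope.
  have hbound (k n : ℕ) (hkn : k ≤ n) (z : ℂ) (hz : ‖z‖ ≤ R (k + 1)) :
      ‖u n z - u k z‖ ≤ (1 / 2) ^ k - (1 / 2) ^ n := by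
    induction n, hkn using Nat.le_induction with
    | base => simp
    | succ n hkn ih =>
      have h := hu n z (hz.trans (hmono (by omega)))
      calc ‖u (n + 1) z - u k z‖ ≤ ‖u (n + 1) z - u n z‖ + ‖u n z - u k z‖ :=
            norm_sub_le_norm_sub_add_norm_sub ..
        _ ≤ (1 / 2) ^ (n + 1) + ((1 / 2) ^ k - (1 / 2) ^ n) := add_le_add h ih
        _ = _ := by ring
  have hbound' (k n : ℕ) (hkn : k ≤ n) (z : ℂ) (hz : ‖z‖ ≤ R (k + 1)) :
      ‖u n z - u k z‖ ≤ (1 / 2) ^ k :=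
    (hbound k n hkn z hz).trans (sub_le_self _ (by positivity))
  have hhalf : Tendsto (fun n : ℕ ↦ (1 / 2 : ℝ) ^ n) atTop (𝓝 0) :=
    tendsto_pow_atTop_nhds_zero_of_lt_one (by norm_num) (by norm_num)
  have hR1 : Tendsto (fun k ↦ R (k + 1)) atTop atTop := (tendsto_add_atTop_iff_nat 1).mpr hRtop
  have hlim (z : ℂ) : ∃ w, Tendsto (fun n ↦ u n z) atTop (𝓝 w) := by
    refine cauchySeq_tendsto_of_complete (Metric.cauchySeq_iff'.mpr fun ε hε ↦ ?_)
    obtain ⟨k, hk, hkz⟩ := ((hhalf.eventually_lt_const hε).and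
      (hR1.eventually_ge_atTop ‖z‖)).exists
    exact ⟨k, fun n hn ↦ by rw [dist_eq_norm]; exact (hbound' k n hn z hkz).trans_lt hk⟩
  choose f hf using hlim
  have hfu (k : ℕ) (z : ℂ) (hz : ‖z‖ ≤ R (k + 1)) : ‖f z - u k z‖ ≤ (1 / 2) ^ k :=
    le_of_tendsto ((hf z).sub_const _).norm
      ((eventually_ge_atTop k).mono fun n hn ↦ hbound' k n hn z hz)
  refine ⟨f, Metric.tendstoLocallyUniformlyOn_iff.mpr fun ε hε x _ ↦
    ⟨Metric.ball 0 (‖x‖ + 1), mem_nhdsWithin_of_mem_nhds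
      (Metric.isOpen_ball.mem_nhds (by simp)), ?_⟩, hfu⟩
  filter_upwards [hhalf.eventually_lt_const hε, hR1.eventually_ge_atTop (‖x‖ + 1)] with n hn hnR y hy
  rw [dist_eq_norm]
  exact (hfu n y ((mem_ball_zero_iff.mp hy).le.trans hnR)).trans_lt hn

theorem iteratedDeriv_aeval (F : ℚ[X]) (σ : ℕ) :
    iteratedDeriv σ (fun z : ℂ ↦ aeval z F) = fun z ↦ aeval z (derivative^[σ] F) := by
  induction σ with
  | zero => simp
  | succ σ ih =>
    rw [iteratedDeriv_succ, ih, Function.iterate_succ_apply']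
    ext z
    exact Polynomial.deriv_aeval _

theorem TendstoLocallyUniformlyOn.iteratedDeriv_univ {u : ℕ → ℂ → ℂ} {f : ℂ → ℂ}
    (h : TendstoLocallyUniformlyOn u f atTop Set.univ) (hu : ∀ n, ContDiff ℂ ⊤ (u n)) (σ : ℕ) :
    TendstoLocallyUniformlyOn (fun n ↦ iteratedDeriv σ (u n)) (iteratedDeriv σ f) atTop
      Set.univ := by
  induction σ with
  | zero => simpa using h
  | succ σ ih =>
    simp only [iteratedDeriv_succ]
    exact ih.deriv (Eventually.of_forall fun n ↦
      ((hu n).differentiable_iteratedDeriv σ (by simp)).differentiableOn) isOpen_univ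

/-- If the corrections `F (n + 1) - F n` are divisible by `G (n + 1)` and these are eventually
divisible by `p ^ (σ + 1)`, then the `σ`-th derivatives of the `F n` are eventually constant at a
root of `p`. -/
theorem iteratedDeriv_eq_aeval_of_pow_dvd {F : ℕ → ℚ[X]} {f : ℂ → ℂ}
    (h : TendstoLocallyUniformlyOn (fun n z ↦ aeval z (F n)) f atTop Set.univ)
    {p : ℚ[X]} {α : ℂ} (hα : aeval α p = 0) {σ n₀ : ℕ}
    (hdvd : ∀ n, n₀ ≤ n → p ^ (σ + 1) ∣ F (n + 1) - F n) :
    iteratedDeriv σ f α = aeval α (derivative^[σ] (F n₀)) := by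
  have hconst (n : ℕ) (hn : n₀ ≤ n) :
      aeval α (derivative^[σ] (F n)) = aeval α (derivative^[σ] (F n₀)) := by
    induction n, hn using Nat.le_induction with
    | base => rfl
    | succ n hn ih =>
      have h1 := pow_sub_dvd_iterate_derivative_of_pow_dvd σ (hdvd n hn)
      rw [Nat.add_sub_cancel_left, pow_one, iterate_derivative_sub] at h1
      have h2 := (map_dvd (aeval α) h1)
      rw [hα, zero_dvd_iff, map_sub, sub_eq_zero] at h2
      rw [h2, ih]
  have hlim := (h.iteratedDeriv_univ (fun n ↦ (F n).contDiff_aeval _) σ).tendsto_at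
    (Set.mem_univ α)
  simp only [iteratedDeriv_aeval] at hlim
  refine tendsto_nhds_unique hlim (tendsto_const_nhds.congr' ?_)
  filter_upwards [eventually_ge_atTop n₀] with n hn
  exact (hconst n hn).symm

theorem Stage.exists_sequence {φ : ℝ → ℝ} (hφ : Tendsto (fun x : ℝ ↦ φ x / x) atTop (𝓝 0))
    (e : ℕ → ℚ[X]) : ∃ s : ℕ → Stage, (s 0).N = 0 ∧ (s 0).R = 0 ∧
      ∀ k, (s k).Next φ e k (s (k + 1)) := by
  have h0 : Stage.Valid 0 ⟨X, X, 0, 0⟩ := ⟨X_ne_zero, rfl, by simp⟩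
  let S (k : ℕ) : {s : Stage // s.Valid k} := Nat.rec ⟨_, h0⟩
    (fun k s ↦ ⟨(s.2.exists_next hφ e).choose, (s.2.exists_next hφ e).choose_spec.1⟩) k
  exact ⟨fun k ↦ (S k).1, rfl, rfl, fun k ↦ ((S k).2.exists_next hφ e).choose_spec.2⟩

theorem Stage.exists_pow_dvd {φ : ℝ → ℝ} {e : ℕ → ℚ[X]} {s : ℕ → Stage}
    (hs : ∀ k, (s k).Next φ e k (s (k + 1))) {j : ℕ} (hj : e j ≠ 0) (n : ℕ) :
    e j ^ n ∣ (s (j + n)).G := by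
  induction n with
  | zero => simp
  | succ n ih =>
    rw [pow_succ]
    exact (mul_dvd_mul_right ih _).trans ((hs (j + n)).mul_dvd j (by omega) hj)

theorem Stage.dvd_of_le {φ : ℝ → ℝ} {e : ℕ → ℚ[X]} {s : ℕ → Stage}
    (hs : ∀ k, (s k).Next φ e k (s (k + 1))) {m n : ℕ} (hmn : m ≤ n) : (s m).G ∣ (s n).G := by
  induction n, hmn using Nat.le_induction with
  | base => rfl
  | succ n _ ih => exact ih.trans (hs n).dvd

/-! ### Counting points and conclusion -/

open IntermediateField in
theorem finite_algebraicPoints (D : ℕ) (N : ℝ) (f : ℂ → ℂ) (r : ℝ) :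
    (algebraicPoints D N f r).Finite := by
  refine (finite_setOf_finrank_le_absLogHeight₁_le D N).subset ?_
  rintro α ⟨hα, -, hfα, hD, hN, -⟩
  refine ⟨hα, le_trans ?_ hD, hN⟩
  -- Needed for comparing degrees: `finrank` is 0 for an infinite extension.
  have : FiniteDimensional ℚ (adjoin ℚ ({α, f α} : Set ℂ)) := by
    refine finiteDimensional_adjoin fun x hx ↦ ?_
    rcases hx with rfl | rfl
    exacts [hα.isIntegral, hfα.isIntegral]
  exact IntermediateField.finrank_le_of_le_right (adjoin.mono _ _ _ (by simp))

open IntermediateField in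
theorem inv_natCast_mem_algebraicPoints {D m : ℕ} (hD : 1 ≤ D) (hm : 1 ≤ m) {N : ℝ} {f : ℂ → ℂ}
    {F : ℚ[X]} (hf : f (m : ℂ)⁻¹ = aeval (m : ℂ)⁻¹ F) (hmN : Real.log m ≤ N)
    (hN : absLogHeight₁ (aeval ((m : ℂ)⁻¹) F) ≤ N) :
    (m : ℂ)⁻¹ ∈ algebraicPoints D N f 1 := by
  have hm' : (m : ℂ)⁻¹ = algebraMap ℚ ℂ (m : ℚ)⁻¹ := by simp
  have hfm : f (m : ℂ)⁻¹ = algebraMap ℚ ℂ (F.eval (m : ℚ)⁻¹) := by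
    rw [hf, hm', aeval_algebraMap_apply, coe_aeval_eq_eval]
  have hm1 : (1 : ℝ) ≤ m := mod_cast hm
  refine ⟨hm' ▸ isAlgebraic_algebraMap _, ?_, hfm ▸ isAlgebraic_algebraMap _, ?_, ?_, hf ▸ hN⟩
  · rw [norm_inv, Complex.norm_natCast]
    exact inv_le_one_of_one_le₀ hm1
  · have hbot : adjoin ℚ ({(m : ℂ)⁻¹, f (m : ℂ)⁻¹} : Set ℂ) = ⊥ := by
      rw [adjoin_eq_bot_iff]
      rintro x (rfl | rfl)
      · exact hm' ▸ IntermediateField.algebraMap_mem _ _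
      · exact hfm ▸ IntermediateField.algebraMap_mem _ _
    rw [hbot, IntermediateField.finrank_bot]
    exact hD
  · have := absLogHeight₁_intCast_div_le 1 m (by positivity) (B := m) (by simpa using hm1) (by simp)
    refine le_trans ?_ (this.trans hmN)
    simp

theorem mainTheorem3 (φ : ℝ → ℝ) (hφ_nonneg : ∀ x : ℝ, 0 ≤ x → 0 ≤ φ x)
    (hφ_lim : Filter.Tendsto (fun x : ℝ => φ x / x) Filter.atTop (nhds 0)) :
    ∃ (N : ℕ → ℝ) (f : ℂ → ℂ),
      (∀ k : ℕ, 1 ≤ k → 0 ≤ N k) ∧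
      StrictMonoOn N (Set.Ici 1) ∧
      Filter.Tendsto N Filter.atTop Filter.atTop ∧
      Differentiable ℂ f ∧
      IsTranscendentalFunction f ∧
      (∀ α : ℂ, IsAlgebraic ℚ α → ∀ σ : ℕ,
        iteratedDeriv σ f α ∈ IntermediateField.adjoin ℚ ({α} : Set ℂ)) ∧
      (∀ D : ℕ, 1 ≤ D → ∀ k : ℕ, D ≤ k →
        (algebraicPoints D (N k) f 1).Finite ∧
        Real.exp ((D : ℝ) * ((D : ℝ) + 1) * φ (N k) - Real.log 2) ≤
          ((algebraicPoints D (N k) f 1).ncard : ℝ)) := by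
  have : Countable ℚ[X] := by
    rw [← Cardinal.mk_le_aleph0_iff]
    exact Polynomial.cardinalMk_le_max.trans (by simp)
  obtain ⟨e, he⟩ := exists_surjective_nat ℚ[X]
  obtain ⟨s, hN0, hR0, hs⟩ := Stage.exists_sequence hφ_lim e
  obtain ⟨f, hf, hfR⟩ := exists_tendstoLocallyUniformlyOn_of_norm_sub_le
    (u := fun n z ↦ aeval z (s n).F) (R := fun n ↦ (s n).R) (fun k ↦ (hs k).R_le)
    (fun k z hz ↦ (hs k).norm_sub_le z hz)
  have hN (n : ℕ) : (n : ℝ) ≤ (s n).N := by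
    induction n with
    | zero => simp [hN0]
    | succ n ih => push_cast; linarith [(hs n).N_le]
  have hR (n : ℕ) : (n : ℝ) ≤ (s n).R := by
    induction n with
    | zero => simp [hR0]
    | succ n ih => push_cast; linarith [(hs n).R_le]
  have hNpos (n : ℕ) : 0 ≤ (s n).N := n.cast_nonneg.trans (hN n)
  have hdvd {m n : ℕ} (hmn : m ≤ n) : (s m).G ∣ (s (n + 1)).F - (s n).F :=
    (Stage.dvd_of_le hs (hmn.trans n.le_succ)).trans (hs n).dvd_sub
  refine ⟨fun n ↦ (s n).N, f, fun k _ ↦ hNpos k, ?_, ?_, ?_, ?_, fun α hα σ ↦ ?_,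
    fun D hD k hDk ↦ ⟨finite_algebraicPoints .., ?_⟩⟩
  · exact (strictMono_nat_of_lt_succ fun n ↦ by linarith [(hs n).N_le]).strictMonoOn _
  · exact tendsto_atTop_mono hN tendsto_natCast_atTop_atTop
  · exact differentiableOn_univ.mp (hf.differentiableOn
      (Eventually.of_forall fun n ↦ (s n).F.differentiable_aeval.differentiableOn) isOpen_univ)
  · refine isTranscendentalFunction_of_growth (x := fun k ↦ (s (k + 1)).R)
      ((tendsto_add_atTop_iff_nat 1).mpr (tendsto_atTop_mono hR tendsto_natCast_atTop_atTop))
      fun k ↦ ?_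
    have hRk : 0 ≤ (s (k + 1)).R := (Nat.cast_nonneg _).trans (hR _)
    have h1 := hfR k (s (k + 1)).R (by simp [abs_of_nonneg hRk])
    have h2 : (1 / 2 : ℝ) ^ k ≤ 1 := pow_le_one₀ (by norm_num) (by norm_num)
    have h3 := norm_sub_norm_le (aeval ((s (k + 1)).R : ℂ) (s k).F) (f (s (k + 1)).R)
    rw [norm_sub_rev] at h3
    -- The `+ 1` in the growth condition absorbs the total later correction.
    linarith [(hs k).growth]
  · obtain ⟨j, hj⟩ := he (minpoly ℚ α)
    have hp : e j ≠ 0 := hj ▸ minpoly.ne_zero hα.isIntegral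
    -- From stage `j` on, `σ + 1` stages supply the factors of `e j ^ (σ + 1)`.
    rw [iteratedDeriv_eq_aeval_of_pow_dvd hf (p := e j) (σ := σ) (n₀ := j + (σ + 1))
      (by rw [hj, minpoly.aeval]) fun n hn ↦ (Stage.exists_pow_dvd hs hp _).trans (hdvd hn)]
    exact IntermediateField.algebra_adjoin_le_adjoin ℚ _ (aeval_mem_adjoin_singleton ℚ α)
  · obtain ⟨k, rfl⟩ : ∃ l, k = l + 1 := ⟨k - 1, by omega⟩
    obtain ⟨M, hM, hpts⟩ := (hs k).points
    have hsub : (fun m : ℕ ↦ (m : ℂ)⁻¹) '' Set.Icc 1 M ⊆ algebraicPoints D (s (k + 1)).N f 1 := by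
      rintro _ ⟨m, ⟨hm, hmM⟩, rfl⟩
      obtain ⟨hG, hlog, hheight⟩ := hpts m hm hmM
      refine inv_natCast_mem_algebraicPoints hD hm (F := (s k).F) ?_ hlog hheight
      have hroot : X - C (m : ℚ)⁻¹ ∣ (s (k + 1)).G := by
        have hm' : (m : ℂ)⁻¹ = algebraMap ℚ ℂ (m : ℚ)⁻¹ := by simp
        rw [hm', aeval_algebraMap_apply, coe_aeval_eq_eval] at hG
        exact dvd_iff_isRoot.mpr (by simpa using hG)
      refine iteratedDeriv_eq_aeval_of_pow_dvd hf (σ := 0) (p := X - C (m : ℚ)⁻¹) (by simp)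
        fun n hn ↦ ?_
      rw [zero_add, pow_one]
      exact hroot.trans ((Stage.dvd_of_le hs (Nat.succ_le_succ hn)).trans (hs n).dvd_sub)
    have hcard := Set.ncard_le_ncard hsub (finite_algebraicPoints ..)
    rw [Set.ncard_image_of_injective _ fun a b h ↦ by simpa using h] at hcard
    rw [← Finset.coe_Icc, Set.ncard_coe_finset, Nat.card_Icc, Nat.add_sub_cancel] at hcard
    refine le_trans ?_ (hM.trans (Nat.cast_le.mpr hcard))
    -- The points are rational, so they count for every `D ≥ 1`; as `φ ≥ 0`, the exponent for `k +
    -- 1` dominates that for `D`.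
    have hDk' : (D : ℝ) ≤ (k + 1 : ℕ) := mod_cast hDk
    have hφk := hφ_nonneg _ (hNpos (k + 1))
    gcongr
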